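/- Let $n$ and $l$ be integers with $1\le l\le n-1$. For a real symmetric $n\times n$ matrix $A$ let $S_k(A)$ be the $k$-th elementary symmetric polynomial of its eigenvalues, counted with multiplicity. Then there is a function $\gamma=\gamma_{n,l}:\mathbb R\to(1,\infty)$, depending only on $n$ and $l$, with the following property. Let $\Omega\subset\mathbb R^n$ be a bounded open convex set with $0\in\Omega$ and Lebesgue measure $|\Omega|$, and let $u\in C^2(\Omega)\cap C(\overline\Omega)$ be convex on $\Omega$ with $$\frac{S_n(D^2u(x))}{S_l(D^2u(x))}=1\quad\text{for all }x\in\Omega,\qquad u(0)=0,\quad Du(0)=0,\qquad u=1\ \text{ on }\partial\Omega.$$ Then $\Omega$ satisfies the $\gamma$-ball condition with $\gamma=\gamma_{n,l}(|\Omega|)$, that is, there are $x_0\in\mathbb R^n$ and $R>0$ such that $$B_{R/\gamma}(x_0)\subset\Omega\subset B_{\gamma R}(x_0),$$ where $B_r(x_0)$ is the open Euclidean ball of radius $r$ and centre $x_0$. -/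

import Mathlib

/-- The Hessian matrix `D²u(x)` of a real function on `ℝⁿ`: the second order partial derivatives
with respect to the standard coordinates. -/
noncomputable def hessianMatrix {n : ℕ} (u : EuclideanSpace ℝ (Fin n) → ℝ)
    (x : EuclideanSpace ℝ (Fin n)) : Matrix (Fin n) (Fin n) ℝ :=
  Matrix.of fun i j =>
    iteratedFDeriv ℝ 2 u x ![EuclideanSpace.single i 1, EuclideanSpace.single j 1]

/-- `S_k(A)`: the `k`-th elementary symmetric polynomial of the eigenvalues of `A`, counted with
multiplicity. It is used for real symmetric `A`, where all eigenvalues are real. -/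
noncomputable def hessianS {n : ℕ} (k : ℕ) (A : Matrix (Fin n) (Fin n) ℝ) : ℝ :=
  A.charpoly.roots.esymm k

/-- The Hessian quotient `S_{k,l}(A) = S_k(A) / S_l(A)`. -/
noncomputable def hessianQuotient {n : ℕ} (k l : ℕ) (A : Matrix (Fin n) (Fin n) ℝ) : ℝ :=
  hessianS k A / hessianS l A

/-- The `γ`-ball condition `γ⁻¹ B_R ⊆ Ω ⊆ γ B_R` for some ball `B_R = B_R(x₀)` of positive radius,
where `c B_R` is the concentric ball `B_{cR}(x₀)`. -/
def GammaBallCondition {n : ℕ} (γ : ℝ) (Ω : Set (EuclideanSpace ℝ (Fin n))) : Prop :=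
  ∃ (x₀ : EuclideanSpace ℝ (Fin n)) (R : ℝ), 0 < R ∧
    Metric.ball x₀ (γ⁻¹ * R) ⊆ Ω ∧ Ω ⊆ Metric.ball x₀ (γ * R)

open Filter Topology
open scoped Matrix

/-! Replace `Ω` by a simplex with vertex `0` of almost maximal volume: it lies in `Ω`, and `Ω` lies
in a dilated parallelepiped on the same edges (`exists_matrix_col_mem_forall_eq_mulVec`). This
yields a form `N`, with an ellipsoid in `Ω`, bounded on `Ω`, and with `det N` bounded through `|Ω|`.
Only the eccentricity of `N` is left to control.

Since `0 ≤ u ≤ 1`, comparing `u` with half of the form gives a point where `D²u ≤ N`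
(`exists_hessianMatrix_le`). The equation makes every product of `n - l` eigenvalues of `D²u` at
least `1`; Weyl monotonicity transfers this to `N`. With the bound on `det N`, all eigenvalues of
`N` are pinched between positive constants, so the ellipsoid is comparable to a ball. -/

/-! ### Eigenvalues and quadratic forms -/

theorem LinearMap.IsSymmetric.inner_apply_self_eq_sum {E : Type*} [NormedAddCommGroup E]
    [InnerProductSpace ℝ E] [FiniteDimensional ℝ E] {n : ℕ} {T : E →ₗ[ℝ] E} (hT : T.IsSymmetric)
    (hn : Module.finrank ℝ E = n) (v : E) :
    inner ℝ v (T v) = ∑ i, hT.eigenvalues hn i * (hT.eigenvectorBasis hn).repr v i ^ 2 := by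
  rw [← (hT.eigenvectorBasis hn).repr.inner_map_map, PiLp.inner_apply]
  refine Finset.sum_congr rfl fun i _ => ?_
  rw [hT.eigenvectorBasis_apply_self_apply]
  simp
  ring

/-- **Weyl monotonicity**: the ordered eigenvalues are monotone in the quadratic form. -/
theorem LinearMap.IsSymmetric.eigenvalues_le_eigenvalues {E : Type*} [NormedAddCommGroup E]
    [InnerProductSpace ℝ E] [FiniteDimensional ℝ E] {n : ℕ} {S T : E →ₗ[ℝ] E}
    (hS : S.IsSymmetric) (hT : T.IsSymmetric) (hn : Module.finrank ℝ E = n)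
    (h : ∀ v, inner ℝ v (S v) ≤ inner ℝ v (T v)) (i : Fin n) :
    hS.eigenvalues hn i ≤ hT.eigenvalues hn i := by
  let bS := hS.eigenvectorBasis hn
  let bT := hT.eigenvectorBasis hn
  -- Only `n - 1` conditions, so some `v ≠ 0` satisfies them all: it lies in the span of the
  -- eigenvectors of `S` with index `≤ i` and of those of `T` with index `≥ i`. Eigenvalues are in
  -- decreasing order.
  let L : E →ₗ[ℝ] ({j : Fin n // j ≠ i} → ℝ) := LinearMap.pi fun j =>
    if i < j then (EuclideanSpace.proj (𝕜 := ℝ) j.1).toLinearMap ∘ₗ bS.repr.toLinearMap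
    else (EuclideanSpace.proj (𝕜 := ℝ) j.1).toLinearMap ∘ₗ bT.repr.toLinearMap
  have hker : LinearMap.ker L ≠ ⊥ := by
    apply LinearMap.ker_ne_bot_of_finrank_lt
    rw [Module.finrank_fintype_fun_eq_card, Fintype.card_subtype_compl, hn]
    simp only [Fintype.card_fin, Fintype.card_unique]
    have := i.pos
    omega
  obtain ⟨v, hv, hv0⟩ := Submodule.exists_mem_ne_zero_of_ne_bot hker
  have hL (j : Fin n) (hj : j ≠ i) :
      (if i < j then bS.repr v j else bT.repr v j) = 0 := by
    have := congrFun (LinearMap.mem_ker.1 hv) ⟨j, hj⟩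
    simp only [L, LinearMap.pi_apply, Pi.zero_apply] at this
    split_ifs at this ⊢ <;> simpa using this
  have hlow : hS.eigenvalues hn i * ‖v‖ ^ 2 ≤ inner ℝ v (S v) := by
    rw [hS.inner_apply_self_eq_sum hn, ← bS.repr.norm_map, EuclideanSpace.real_norm_sq_eq,
      Finset.mul_sum]
    refine Finset.sum_le_sum fun j _ => ?_
    rcases le_or_gt j i with hj | hj
    · exact mul_le_mul_of_nonneg_right (hS.eigenvalues_antitone hn hj) (sq_nonneg _)
    · have := hL j hj.ne'
      rw [if_pos hj] at this
      simp [bS] at this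
      simp [bS, this]
  have hup : inner ℝ v (T v) ≤ hT.eigenvalues hn i * ‖v‖ ^ 2 := by
    rw [hT.inner_apply_self_eq_sum hn, ← bT.repr.norm_map, EuclideanSpace.real_norm_sq_eq,
      Finset.mul_sum]
    refine Finset.sum_le_sum fun j _ => ?_
    rcases le_or_gt i j with hj | hj
    · exact mul_le_mul_of_nonneg_right (hT.eigenvalues_antitone hn hj) (sq_nonneg _)
    · have := hL j hj.ne
      rw [if_neg hj.not_gt] at this
      simp [bT] at this
      simp [bT, this]
  exact le_of_mul_le_mul_right (hlow.trans ((h v).trans hup)) (by positivity)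

namespace Matrix.IsHermitian

variable {ι : Type*} [Fintype ι] [DecidableEq ι] {M N : Matrix ι ι ℝ}

theorem eigenvalues_le_eigenvalues (hM : M.IsHermitian) (hN : N.IsHermitian)
    (h : ∀ v : ι → ℝ, v ⬝ᵥ M *ᵥ v ≤ v ⬝ᵥ N *ᵥ v) (i : ι) :
    hM.eigenvalues i ≤ hN.eigenvalues i := by
  refine LinearMap.IsSymmetric.eigenvalues_le_eigenvalues _ _ _ (fun v => ?_) _
  have := h v.ofLp
  simpa [EuclideanSpace.inner_eq_star_dotProduct, dotProduct_comm] using this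

theorem dotProduct_mulVec_eq_sum (hM : M.IsHermitian) (v : ι → ℝ) :
    v ⬝ᵥ M *ᵥ v =
      ∑ i, hM.eigenvalues i * hM.eigenvectorBasis.repr (WithLp.toLp 2 v) i ^ 2 := by
  have := (isSymmetric_toEuclideanLin_iff.mpr hM).inner_apply_self_eq_sum
    finrank_euclideanSpace (WithLp.toLp 2 v)
  rw [EuclideanSpace.inner_eq_star_dotProduct] at this
  simp only [toLpLin_apply, star_trivial] at this
  rw [dotProduct_comm, this,
    ← (Fintype.equivOfCardEq (Fintype.card_fin (Fintype.card ι))).symm.sum_comp]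
  simp [eigenvalues, eigenvectorBasis, eigenvalues₀]

theorem sum_repr_sq (hM : M.IsHermitian) (v : ι → ℝ) :
    ∑ i, hM.eigenvectorBasis.repr (WithLp.toLp 2 v) i ^ 2 = v ⬝ᵥ v := by
  rw [← EuclideanSpace.real_norm_sq_eq, LinearIsometryEquiv.norm_map,
    EuclideanSpace.real_norm_sq_eq]
  simp [dotProduct, sq]

theorem dotProduct_mulVec_le (hM : M.IsHermitian) {K : ℝ} (h : ∀ i, hM.eigenvalues i ≤ K)
    (v : ι → ℝ) : v ⬝ᵥ M *ᵥ v ≤ K * (v ⬝ᵥ v) := by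
  rw [hM.dotProduct_mulVec_eq_sum, ← hM.sum_repr_sq, Finset.mul_sum]
  exact Finset.sum_le_sum fun i _ => mul_le_mul_of_nonneg_right (h i) (sq_nonneg _)

theorem le_dotProduct_mulVec (hM : M.IsHermitian) {K : ℝ} (h : ∀ i, K ≤ hM.eigenvalues i)
    (v : ι → ℝ) : K * (v ⬝ᵥ v) ≤ v ⬝ᵥ M *ᵥ v := by
  rw [hM.dotProduct_mulVec_eq_sum, ← hM.sum_repr_sq, Finset.mul_sum]
  exact Finset.sum_le_sum fun i _ => mul_le_mul_of_nonneg_right (h i) (sq_nonneg _)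

end Matrix.IsHermitian

/-! ### Eigenvalue bounds from the equation -/

theorem hessianS_eq_sum {n : ℕ} (k : ℕ) {M : Matrix (Fin n) (Fin n) ℝ} (hM : M.IsHermitian) :
    hessianS k M = ∑ T ∈ Finset.powersetCard k Finset.univ, ∏ i ∈ T, hM.eigenvalues i := by
  rw [hessianS, hM.roots_charpoly_eq_eigenvalues, ← Finset.esymm_map_val]
  rfl

/-- `S_n` is the full product, while `S_l` dominates its single term indexed by the complement of
`S`; cancel that term in `S_n = S_l`. -/
theorem one_le_prod_eigenvalues_of_hessianQuotient_eq_one {n l : ℕ} (hl : l ≤ n)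
    {M : Matrix (Fin n) (Fin n) ℝ} (hM : M.PosSemidef) (h : hessianQuotient n l M = 1) :
    (∀ i, 0 < hM.1.eigenvalues i) ∧
      ∀ S : Finset (Fin n), S.card = n - l → 1 ≤ ∏ i ∈ S, hM.1.eigenvalues i := by
  have hne : hessianS l M ≠ 0 := fun h0 => by simp [hessianQuotient, h0] at h
  have heq : hessianS n M = hessianS l M := by rwa [hessianQuotient, div_eq_one_iff_eq hne] at h
  have hn : hessianS n M = ∏ i, hM.1.eigenvalues i := by
    rw [hessianS_eq_sum n hM.1]
    have : Finset.powersetCard n (Finset.univ : Finset (Fin n)) = {Finset.univ} := by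
      simpa using Finset.powersetCard_self (Finset.univ : Finset (Fin n))
    rw [this, Finset.sum_singleton]
  have hpos (i : Fin n) : 0 < hM.1.eigenvalues i := by
    refine lt_of_le_of_ne (hM.eigenvalues_nonneg i) fun h0 => hne ?_
    rw [← heq, hn]
    exact Finset.prod_eq_zero (Finset.mem_univ i) h0.symm
  refine ⟨hpos, fun S hS => ?_⟩
  have hle : ∏ i ∈ Sᶜ, hM.1.eigenvalues i ≤ hessianS l M := by
    rw [hessianS_eq_sum l hM.1]
    refine Finset.single_le_sum (f := fun T => ∏ i ∈ T, hM.1.eigenvalues i)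
      (fun T _ => Finset.prod_nonneg fun i _ => (hpos i).le) ?_
    rw [Finset.mem_powersetCard_univ, Finset.card_compl, Fintype.card_fin, hS]
    omega
  rw [← heq, hn, ← Finset.prod_mul_prod_compl S] at hle
  exact le_of_mul_le_mul_right (by simpa using hle) (Finset.prod_pos fun i _ => hpos i)

/-- Any `k` factors include one that is at least `1`; peel it off and induct. -/
theorem Finset.one_le_prod_of_card_le {ι : Type*} [DecidableEq ι] {f : ι → ℝ} {k : ℕ}
    (hk : 1 ≤ k) (hf : ∀ i, 0 < f i) (h : ∀ S : Finset ι, S.card = k → 1 ≤ ∏ i ∈ S, f i)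
    (S : Finset ι) (hS : k ≤ S.card) : 1 ≤ ∏ i ∈ S, f i := by
  obtain ⟨m, hm⟩ : ∃ m, S.card = k + m := ⟨S.card - k, by omega⟩
  induction m generalizing S with
  | zero => exact h S hm
  | succ m ih =>
    obtain ⟨i, hi, hi1⟩ : ∃ i ∈ S, 1 ≤ f i := by
      obtain ⟨T, hTS, hT⟩ := Finset.exists_subset_card_eq hS
      by_contra! hlt
      have hne : T.Nonempty := Finset.card_pos.1 (by omega)
      refine (h T hT).not_gt ?_
      simpa using Finset.prod_lt_prod_of_nonempty (fun i _ => hf i)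
        (fun i hi => hlt i (hTS hi)) hne
    rw [← Finset.mul_prod_erase S f hi]
    have hc : (S.erase i).card = k + m := by rw [Finset.card_erase_of_mem hi]; omega
    exact one_le_mul_of_one_le_of_one_le hi1 (ih _ (by omega) hc)

/-- As `k < card ι`, the factors other than `f i` still have product at least `1`, whence the upper
bound. The lower bound follows because the full product is at least `1` and the other factors are at
most `K`. -/
theorem Finset.bounds_of_one_le_prod {ι : Type*} [Fintype ι] [DecidableEq ι] {f : ι → ℝ} {k : ℕ}
    (hk : 1 ≤ k) (hkι : k < Fintype.card ι) (hf : ∀ i, 0 < f i)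
    (h : ∀ S : Finset ι, S.card = k → 1 ≤ ∏ i ∈ S, f i) {K : ℝ} (hK : 1 ≤ K)
    (hfK : ∏ i, f i ≤ K) (i : ι) : f i ≤ K ∧ (K ^ Fintype.card ι)⁻¹ ≤ f i := by
  have hup (i : ι) : f i ≤ K := by
    refine le_trans ?_ hfK
    rw [← Finset.mul_prod_erase Finset.univ f (Finset.mem_univ i)]
    refine le_mul_of_one_le_right (hf i).le (Finset.one_le_prod_of_card_le hk hf h _ ?_)
    rw [Finset.card_erase_of_mem (Finset.mem_univ i), Finset.card_univ]
    omega
  refine ⟨hup i, ?_⟩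
  have h1 : 1 ≤ ∏ i, f i := Finset.one_le_prod_of_card_le hk hf h _ (by simpa using hkι.le)
  rw [← Finset.mul_prod_erase Finset.univ f (Finset.mem_univ i)] at h1
  have h2 : ∏ j ∈ Finset.univ.erase i, f j ≤ K ^ Fintype.card ι := by
    calc ∏ j ∈ Finset.univ.erase i, f j ≤ ∏ j ∈ Finset.univ.erase i, K :=
          Finset.prod_le_prod (fun j _ => (hf j).le) fun j _ => hup j
      _ ≤ K ^ Fintype.card ι := by
          rw [Finset.prod_const]
          exact pow_le_pow_right₀ hK (Finset.card_le_univ _)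
  rw [inv_le_iff_one_le_mul₀ (by positivity)]
  exact h1.trans (mul_le_mul_of_nonneg_left h2 (hf i).le)

/-! ### Second-order conditions and Hessian comparison -/

/-- If `c > 0`, then `x` is also a local minimum, so `g` is locally constant and `c = 0`. -/
theorem IsLocalMax.second_deriv_nonpos {g g' : ℝ → ℝ} {x c : ℝ} (hmax : IsLocalMax g x)
    (hg : ∀ᶠ s in 𝓝 x, HasDerivAt g (g' s) s) (hg' : HasDerivAt g' c x) : c ≤ 0 := by
  by_contra! hc
  have hd : deriv g =ᶠ[𝓝 x] g' := hg.mono fun s hs => hs.deriv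
  have hdd : deriv (deriv g) x = c := by rw [hd.deriv_eq, hg'.deriv]
  have hmin : IsLocalMin g x :=
    isLocalMin_of_deriv_deriv_pos (hdd ▸ hc) hmax.deriv_eq_zero hg.self_of_nhds.continuousAt
  have hconst : g =ᶠ[𝓝 x] fun _ => g x := by
    filter_upwards [hmin, hmax] with s h1 h2 using le_antisymm h2 h1
  have h0 : deriv g =ᶠ[𝓝 x] fun _ => 0 := by
    simpa using hconst.deriv
  rw [h0.deriv_eq, deriv_const] at hdd
  exact hc.ne hdd

section Hessian

variable {n : ℕ} {u : EuclideanSpace ℝ (Fin n) → ℝ} {x : EuclideanSpace ℝ (Fin n)}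

theorem dotProduct_hessianMatrix_mulVec (v : EuclideanSpace ℝ (Fin n)) :
    v.ofLp ⬝ᵥ hessianMatrix u x *ᵥ v.ofLp = fderiv ℝ (fderiv ℝ u) x v v := by
  have hv : v = ∑ i, v.ofLp i • EuclideanSpace.single i (1 : ℝ) := by
    ext j
    simp [Pi.single_apply]
  conv_rhs => rw [hv]
  simp only [map_sum, map_smul, sum_apply, smul_apply,
    smul_eq_mul, dotProduct, Matrix.mulVec, hessianMatrix, Matrix.of_apply,
    iteratedFDeriv_two_apply, Finset.mul_sum]
  rw [Finset.sum_comm]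
  refine Finset.sum_congr rfl fun i _ => Finset.sum_congr rfl fun j _ => ?_
  simp
  ring

theorem isHermitian_hessianMatrix (hu : ContDiffAt ℝ 2 u x) : (hessianMatrix u x).IsHermitian := by
  refine Matrix.IsHermitian.ext fun i j => ?_
  have := hu.isSymmSndFDerivAt (by simp)
  simpa [hessianMatrix, iteratedFDeriv_two_apply] using this _ _

theorem ContDiffAt.hasDerivAt_line (hu : ContDiffAt ℝ 2 u x) (v : EuclideanSpace ℝ (Fin n)) :
    ∀ᶠ s : ℝ in 𝓝 0, HasDerivAt (fun s : ℝ => u (x + s • v)) (fderiv ℝ u (x + s • v) v) s := by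
  have hdiff : ∀ᶠ y in 𝓝 x, DifferentiableAt ℝ u y :=
    (hu.eventually (by simp)).mono fun y hy => hy.differentiableAt (by simp)
  have hline : Tendsto (fun s : ℝ => x + s • v) (𝓝 0) (𝓝 x) := by
    have : Continuous fun s : ℝ => x + s • v := by fun_prop
    simpa using this.tendsto 0
  filter_upwards [hline.eventually hdiff] with s hs
  have h1 : HasDerivAt (fun s : ℝ => x + s • v) v s := by
    simpa using ((hasDerivAt_id s).smul_const v).const_add x
  exact hs.hasFDerivAt.comp_hasDerivAt s h1

theorem ContDiffAt.hasDerivAt_fderiv_line (hu : ContDiffAt ℝ 2 u x)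
    (v : EuclideanSpace ℝ (Fin n)) :
    HasDerivAt (fun s : ℝ => fderiv ℝ u (x + s • v) v)
      (v.ofLp ⬝ᵥ hessianMatrix u x *ᵥ v.ofLp) 0 := by
  rw [dotProduct_hessianMatrix_mulVec]
  have hd : DifferentiableAt ℝ (fderiv ℝ u) x :=
    (hu.fderiv_right (m := 1) (by norm_num)).differentiableAt (by simp)
  have h1 : HasDerivAt (fun s : ℝ => x + s • v) v 0 := by
    simpa using ((hasDerivAt_id (0 : ℝ)).smul_const v).const_add x
  have h2 : HasDerivAt (fun s : ℝ => fderiv ℝ u (x + s • v)) (fderiv ℝ (fderiv ℝ u) x v) 0 := by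
    have hx : HasFDerivAt (fderiv ℝ u) (fderiv ℝ (fderiv ℝ u) x) (x + (0 : ℝ) • v) := by
      simpa using hd.hasFDerivAt
    exact hx.comp_hasDerivAt 0 h1
  simpa using h2.clm_apply (hasDerivAt_const 0 v)

theorem posSemidef_hessianMatrix_of_convexOn {Ω : Set (EuclideanSpace ℝ (Fin n))}
    (hΩ : IsOpen Ω) (hu : ContDiffAt ℝ 2 u x) (hconv : ConvexOn ℝ Ω u) (hx : x ∈ Ω) :
    (hessianMatrix u x).PosSemidef := by
  refine Matrix.PosSemidef.of_dotProduct_mulVec_nonneg (isHermitian_hessianMatrix hu) fun w => ?_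
  set v : EuclideanSpace ℝ (Fin n) := WithLp.toLp 2 w with hv
  have hneg : Tendsto (fun s : ℝ => -s) (𝓝 0) (𝓝 0) := by
    simpa using (continuous_neg (G := ℝ)).tendsto 0
  have hmem : ∀ᶠ s : ℝ in 𝓝 0, x + s • v ∈ Ω := by
    have : Continuous fun s : ℝ => x + s • v := by fun_prop
    exact this.continuousAt.eventually_mem (hΩ.mem_nhds (by simpa using hx))
  -- Symmetrizing in `s` turns midpoint convexity into a local maximum at `0`.
  let g : ℝ → ℝ := fun s => -(u (x + s • v) + u (x + (-s) • v))
  let g' : ℝ → ℝ := fun s => -(fderiv ℝ u (x + s • v) v - fderiv ℝ u (x + (-s) • v) v)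
  have hmax : IsLocalMax g 0 := by
    filter_upwards [hmem, hneg.eventually hmem] with s h1 h2
    have := hconv.2 h1 h2 (show (0 : ℝ) ≤ 1 / 2 by norm_num)
      (show (0 : ℝ) ≤ 1 / 2 by norm_num) (by norm_num)
    have he : (1 / 2 : ℝ) • (x + s • v) + (1 / 2 : ℝ) • (x + (-s) • v) = x := by module
    rw [he] at this
    simp only [smul_eq_mul] at this
    simp only [g, neg_zero, zero_smul, add_zero]
    linarith
  have hd := hu.hasDerivAt_line v
  have hg : ∀ᶠ s in 𝓝 0, HasDerivAt g (g' s) s := by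
    filter_upwards [hd, hneg.eventually hd] with s h1 h2
    have h3 := h2.comp s (hasDerivAt_neg s)
    refine (h1.add h3).neg.congr_deriv ?_
    simp only [g']
    ring
  have hdd := hu.hasDerivAt_fderiv_line v
  have hg' : HasDerivAt g' (-(2 * (v.ofLp ⬝ᵥ hessianMatrix u x *ᵥ v.ofLp))) 0 := by
    have h0 : HasDerivAt (fun s : ℝ => fderiv ℝ u (x + s • v) v)
      (v.ofLp ⬝ᵥ hessianMatrix u x *ᵥ v.ofLp) (-0) := by simpa using hdd
    have h3 := h0.comp 0 (hasDerivAt_neg 0)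
    refine (hdd.sub h3).neg.congr_deriv ?_
    ring
  have := hmax.second_deriv_nonpos hg hg'
  rw [star_trivial]
  change 0 ≤ v.ofLp ⬝ᵥ hessianMatrix u x *ᵥ v.ofLp
  linarith

theorem dotProduct_mulVec_add_smul (N : Matrix (Fin n) (Fin n) ℝ) (y v : Fin n → ℝ) (s : ℝ) :
    (y + s • v) ⬝ᵥ N *ᵥ (y + s • v) =
      y ⬝ᵥ N *ᵥ y + s * (y ⬝ᵥ N *ᵥ v + v ⬝ᵥ N *ᵥ y) + s ^ 2 * (v ⬝ᵥ N *ᵥ v) := by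
  simp only [Matrix.mulVec_add, Matrix.mulVec_smul, dotProduct_add, add_dotProduct,
    dotProduct_smul, smul_dotProduct, smul_eq_mul]
  ring

/-- If an ellipsoid of a quadratic form `N` lies in `Ω`, on which `u` takes values in `[0, 1]`,
then somewhere in `Ω` the Hessian of `u` is bounded by `N`. -/
theorem exists_hessianMatrix_le {Ω : Set (EuclideanSpace ℝ (Fin n))} (hΩ : IsOpen Ω)
    (hbdd : Bornology.IsBounded Ω) (hu : ContDiffOn ℝ 2 u Ω)
    (hu0 : ∀ y ∈ Ω, 0 ≤ u y) (hu1 : ∀ y ∈ Ω, u y ≤ 1) (N : Matrix (Fin n) (Fin n) ℝ)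
    (c : EuclideanSpace ℝ (Fin n))
    (hN : ∀ y, (y - c).ofLp ⬝ᵥ N *ᵥ (y - c).ofLp ≤ 3 → y ∈ Ω) :
    ∃ z ∈ Ω, ∀ v : Fin n → ℝ, v ⬝ᵥ hessianMatrix u z *ᵥ v ≤ v ⬝ᵥ N *ᵥ v := by
  let q : EuclideanSpace ℝ (Fin n) → ℝ := fun y => (y - c).ofLp ⬝ᵥ N *ᵥ (y - c).ofLp
  have hq : Continuous q := by
    simp only [q, dotProduct, Matrix.mulVec]
    fun_prop
  -- `N` is not assumed definite; boundedness comes from that of `Ω`.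
  have hK : IsCompact {y | q y ≤ 3} :=
    Metric.isCompact_of_isClosed_isBounded (isClosed_le hq continuous_const) (hbdd.subset hN)
  have hc3 : c ∈ {y | q y ≤ 3} := by simp [q]
  have hcont : ContinuousOn (fun y => u y - q y / 2) {y | q y ≤ 3} :=
    (hu.continuousOn.mono hN).sub (by fun_prop)
  obtain ⟨z, hz, hzmax⟩ := hK.exists_isMaxOn ⟨c, hc3⟩ hcont
  have hzΩ : z ∈ Ω := hN z hz
  -- Comparison with the centre gives `q z ≤ 2`, so the maximum is interior; any level above `2`
  -- would do.
  have hz3 : q z < 3 := by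
    have h1 : u c - q c / 2 ≤ u z - q z / 2 := hzmax hc3
    have h2 : q c = 0 := by simp [q]
    have h3 := hu0 c (hN c hc3)
    have h4 := hu1 z hzΩ
    linarith
  refine ⟨z, hzΩ, fun w => ?_⟩
  set v : EuclideanSpace ℝ (Fin n) := WithLp.toLp 2 w with hv
  have huz : ContDiffAt ℝ 2 u z := hu.contDiffAt (hΩ.mem_nhds hzΩ)
  set a := (z - c).ofLp ⬝ᵥ N *ᵥ v.ofLp + v.ofLp ⬝ᵥ N *ᵥ (z - c).ofLp with ha
  set k := v.ofLp ⬝ᵥ N *ᵥ v.ofLp with hk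
  have hline (s : ℝ) : q (z + s • v) = q z + s * a + s ^ 2 * k := by
    have : (z + s • v - c).ofLp = (z - c).ofLp + s • v.ofLp := by
      ext i; simp; ring
    simp only [q, this, dotProduct_mulVec_add_smul]
    rfl
  let g : ℝ → ℝ := fun s => u (z + s • v) - (q z + s * a + s ^ 2 * k) / 2
  let g' : ℝ → ℝ := fun s => fderiv ℝ u (z + s • v) v - (a + 2 * s * k) / 2
  have hmax : IsLocalMax g 0 := by
    have hcl : Continuous fun s : ℝ => q (z + s • v) := by fun_prop
    have : ∀ᶠ s : ℝ in 𝓝 0, q (z + s • v) < 3 :=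
      hcl.continuousAt.eventually_lt continuousAt_const (by simpa using hz3)
    filter_upwards [this] with s hs
    have h1 : u (z + s • v) - q (z + s • v) / 2 ≤ u z - q z / 2 := hzmax hs.le
    rw [hline] at h1
    simpa [g] using h1
  have hg : ∀ᶠ s in 𝓝 0, HasDerivAt g (g' s) s := by
    filter_upwards [huz.hasDerivAt_line v] with s hs
    have h1 := (((hasDerivAt_id s).mul_const a).const_add (q z)).add
      ((hasDerivAt_pow 2 s).mul_const k)
    refine (hs.sub (h1.div_const 2)).congr_deriv ?_
    simp only [g']
    norm_num
  have hg' : HasDerivAt g' (v.ofLp ⬝ᵥ hessianMatrix u z *ᵥ v.ofLp - k) 0 := by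
    have h1 := ((((hasDerivAt_id (0 : ℝ)).const_mul 2).mul_const k).const_add a).div_const 2
    refine ((huz.hasDerivAt_fderiv_line v).sub h1).congr_deriv ?_
    ring
  have := hmax.second_deriv_nonpos hg hg'
  change v.ofLp ⬝ᵥ hessianMatrix u z *ᵥ v.ofLp ≤ k
  linarith

end Hessian

/-! ### The bounds `0 ≤ u ≤ 1` -/

theorem ConvexOn.nonneg_of_gradient_eq_zero {E : Type*} [NormedAddCommGroup E]
    [InnerProductSpace ℝ E] [CompleteSpace E] {Ω : Set E} {u : E → ℝ} (hconv : ConvexOn ℝ Ω u)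
    (h0 : (0 : E) ∈ Ω) (hd : DifferentiableAt ℝ u 0) (hu0 : u 0 = 0) (hgrad : gradient u 0 = 0)
    {y : E} (hy : y ∈ Ω) : 0 ≤ u y := by
  have hf : fderiv ℝ u 0 = 0 := by
    simpa [gradient] using hgrad
  have hderiv : HasDerivAt (fun s : ℝ => u (s • y)) 0 0 := by
    have h1 : HasDerivAt (fun s : ℝ => s • y) y 0 := by
      simpa using (hasDerivAt_id (0 : ℝ)).smul_const y
    have h2 : HasFDerivAt u (0 : E →L[ℝ] ℝ) ((0 : ℝ) • y) := by
      rw [← hf, zero_smul]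
      exact hd.hasFDerivAt
    exact h2.comp_hasDerivAt 0 h1
  have hc : ConvexOn ℝ (Set.Icc (0 : ℝ) 1) fun s : ℝ => u (s • y) := by
    refine ⟨convex_Icc 0 1, fun s hs t ht a b ha hb hab => ?_⟩
    have hm (r : ℝ) (hr : r ∈ Set.Icc (0 : ℝ) 1) : r • y ∈ Ω :=
      hconv.1.smul_mem_of_zero_mem h0 hy hr
    have := hconv.2 (hm s hs) (hm t ht) ha hb hab
    convert this using 2
    module
  have := hc.le_slope_of_hasDerivAt (x := 0) (y := 1) (by simp) (by simp) one_pos hderiv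
  simpa [slope_def_field, hu0] using this

/-- If the maximum over the closure is at an interior `z`, moving outward along the ray from `0`
gives `(1 + s) u(z) ≤ u((1 + s) z) ≤ u(z)`, so `u(z) ≤ 0 ≤ m`. -/
theorem ConvexOn.le_of_le_on_frontier {E : Type*} [NormedAddCommGroup E] [NormedSpace ℝ E]
    [FiniteDimensional ℝ E] {Ω : Set E} {u : E → ℝ} {m : ℝ} (hm : 0 ≤ m) (hΩ : IsOpen Ω)
    (hbdd : Bornology.IsBounded Ω) (hconv : ConvexOn ℝ Ω u) (hcont : ContinuousOn u (closure Ω))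
    (h0 : (0 : E) ∈ Ω) (hu0 : u 0 = 0) (hfr : ∀ x ∈ frontier Ω, u x ≤ m) {y : E} (hy : y ∈ Ω) :
    u y ≤ m := by
  have : ProperSpace E := FiniteDimensional.proper_real E
  obtain ⟨z, hz, hzmax⟩ := hbdd.isCompact_closure.exists_isMaxOn ⟨0, subset_closure h0⟩ hcont
  refine (hzmax (subset_closure hy)).trans ?_
  by_cases hzΩ : z ∈ Ω
  · have hl : Continuous fun s : ℝ => (1 + s) • z := by fun_prop
    have he : ∀ᶠ s : ℝ in 𝓝 0, (1 + s) • z ∈ Ω :=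
      hl.continuousAt.eventually_mem (hΩ.mem_nhds (by simpa using hzΩ))
    obtain ⟨s, hs, hs0⟩ : ∃ s : ℝ, (1 + s) • z ∈ Ω ∧ 0 < s :=
      ((he.filter_mono nhdsWithin_le_nhds).and
        (self_mem_nhdsWithin (s := Set.Ioi (0 : ℝ)))).exists
    have h1 : 0 < 1 + s := by linarith
    have h2 := hconv.2 h0 hs (show 0 ≤ s / (1 + s) by positivity)
      (show 0 ≤ 1 / (1 + s) by positivity) (by field_simp; ring)
    have h3 : (s / (1 + s)) • (0 : E) + (1 / (1 + s)) • (1 + s) • z = z := by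
      rw [smul_zero, zero_add, smul_smul, one_div_mul_cancel h1.ne', one_smul]
    have h4 : u ((1 + s) • z) ≤ u z := hzmax (subset_closure hs)
    rw [h3, hu0] at h2
    simp only [smul_eq_mul, mul_zero, zero_add] at h2
    have h5 : u z * (1 + s) ≤ u ((1 + s) • z) := by
      rw [one_div, inv_mul_eq_div, le_div_iff₀ h1] at h2
      exact h2
    refine le_trans ?_ hm
    nlinarith
  · exact hfr z ⟨hz, by rwa [hΩ.interior_eq]⟩

/-! ### Almost maximal simplices -/

theorem Convex.sum_smul_mem_of_zero_mem {ι E : Type*} [AddCommGroup E]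
    [Module ℝ E] {s : Set E} (hs : Convex ℝ s) (h0 : (0 : E) ∈ s) (t : Finset ι) {w : ι → ℝ}
    {v : ι → E} (hw : ∀ i ∈ t, 0 ≤ w i) (hw1 : ∑ i ∈ t, w i ≤ 1) (hv : ∀ i ∈ t, v i ∈ s) :
    ∑ i ∈ t, w i • v i ∈ s := by
  rcases (Finset.sum_nonneg hw).eq_or_lt' with h | h
  · rw [Finset.sum_eq_zero fun i hi => by
      rw [(Finset.sum_eq_zero_iff_of_nonneg hw).1 h i hi, zero_smul]]
    exact h0
  · have := hs.smul_mem_of_zero_mem h0 (hs.centerMass_mem hw h hv) ⟨h.le, hw1⟩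
    rwa [Finset.centerMass, smul_inv_smul₀ h.ne'] at this

/-- A bounded open set containing the origin contains the columns of an invertible matrix `A` such
that all its points have coordinates at most `2` with respect to these columns. -/
theorem exists_matrix_col_mem_forall_eq_mulVec {n : ℕ} {Ω : Set (EuclideanSpace ℝ (Fin n))}
    (hΩ : IsOpen Ω) (hbdd : Bornology.IsBounded Ω) (h0 : (0 : EuclideanSpace ℝ (Fin n)) ∈ Ω) :
    ∃ A : Matrix (Fin n) (Fin n) ℝ, A.det ≠ 0 ∧ (∀ j, WithLp.toLp 2 (Aᵀ j) ∈ Ω) ∧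
      ∀ x ∈ Ω, ∃ y : Fin n → ℝ, x.ofLp = A *ᵥ y ∧ ∀ i, |y i| ≤ 2 := by
  let f : (Fin n → EuclideanSpace ℝ (Fin n)) → ℝ := fun v => |(Matrix.of fun i j => v j i).det|
  have hf : Continuous f := by
    refine (Continuous.matrix_det ?_).abs
    exact continuous_matrix fun i j => by simp only [Matrix.of_apply]; fun_prop
  let P : Set (Fin n → EuclideanSpace ℝ (Fin n)) := Set.univ.pi fun _ => Ω
  have hB : BddAbove (f '' P) :=
    ((isCompact_univ_pi fun _ => hbdd.isCompact_closure).image hf).bddAbove.mono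
      (Set.image_mono (Set.pi_mono fun _ _ => subset_closure))
  obtain ⟨v₀, hv₀, hfv₀⟩ : ∃ v ∈ P, 0 < f v := by
    have hc : Continuous fun (s : ℝ) (i : Fin n) => s • EuclideanSpace.single i (1 : ℝ) := by
      fun_prop
    have hP : P ∈ 𝓝 (fun i : Fin n => (0 : ℝ) • EuclideanSpace.single i (1 : ℝ)) := by
      refine (isOpen_set_pi Set.finite_univ fun _ _ => hΩ).mem_nhds fun i _ => ?_
      simpa using h0
    obtain ⟨s, hs, hs0⟩ := ((((hc.tendsto 0).eventually hP).filter_mono nhdsWithin_le_nhds).and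
        (self_mem_nhdsWithin (s := Set.Ioi (0 : ℝ)))).exists
    refine ⟨_, hs, ?_⟩
    have : (Matrix.of fun i j : Fin n => (s • EuclideanSpace.single j (1 : ℝ) :
        EuclideanSpace ℝ (Fin n)) i) = s • (1 : Matrix (Fin n) (Fin n) ℝ) := by
      ext i j
      simp [Matrix.one_apply]
    simp only [f, this, Matrix.det_smul, Matrix.det_one]
    have : 0 < s := hs0
    positivity
  have hM : 0 < sSup (f '' P) := hfv₀.trans_le (le_csSup hB ⟨v₀, hv₀, rfl⟩)
  -- The supremum need not be attained on the open set, so half of it is used; this is the source of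
  -- the bound `2`.
  obtain ⟨_, ⟨v, hv, rfl⟩, hvM⟩ :=
    exists_lt_of_lt_csSup (Set.Nonempty.image f ⟨v₀, hv₀⟩) (half_lt_self hM)
  set A : Matrix (Fin n) (Fin n) ℝ := Matrix.of fun i j => v j i with hA
  have hdet : 0 < |A.det| := (half_pos hM).trans hvM
  -- By Cramer's rule the coordinates of `x` are quotients of determinants; the numerator has a
  -- column replaced by `x ∈ Ω`, so it is at most the supremum.
  refine ⟨A, abs_pos.1 hdet, fun j => hv j trivial, fun x hx => ⟨A.det⁻¹ • A.cramer x.ofLp, ?_, ?_⟩⟩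
  · rw [Matrix.mulVec_smul, Matrix.mulVec_cramer, inv_smul_smul₀ (abs_pos.1 hdet)]
  · intro i
    have hle : |A.cramer x.ofLp i| ≤ sSup (f '' P) := by
      refine le_csSup hB ⟨Function.update v i x, ?_, ?_⟩
      · intro j _
        rcases eq_or_ne j i with rfl | h
        · simpa using hx
        · simpa [h] using hv j trivial
      · simp only [f, Matrix.cramer_apply]
        congr 2
        ext k j
        rcases eq_or_ne j i with rfl | h
        · simp
        · simp [h, hA]
    rw [Pi.smul_apply, smul_eq_mul, abs_mul, abs_inv, inv_mul_le_iff₀ hdet]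
    have : sSup (f '' P) / 2 < |A.det| := hvM
    linarith

theorem volume_le_of_forall_eq_mulVec {n : ℕ} {Ω : Set (EuclideanSpace ℝ (Fin n))}
    {A : Matrix (Fin n) (Fin n) ℝ} {b : ℝ} (hb : 0 ≤ b)
    (h : ∀ x ∈ Ω, ∃ y : Fin n → ℝ, x.ofLp = A *ᵥ y ∧ ∀ i, |y i| ≤ b) :
    (MeasureTheory.volume Ω).toReal ≤ |A.det| * (2 * b) ^ n := by
  let Q : Set (EuclideanSpace ℝ (Fin n)) := WithLp.ofLp ⁻¹' Set.Icc (fun _ => -b) (fun _ => b)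
  have hsub : Ω ⊆ Matrix.toEuclideanLin A '' Q := by
    intro x hx
    obtain ⟨y, hxy, hy⟩ := h x hx
    refine ⟨WithLp.toLp 2 y, ⟨fun i => (abs_le.1 (hy i)).1, fun i => (abs_le.1 (hy i)).2⟩, ?_⟩
    ext i
    simp [hxy]
  have hQ : MeasureTheory.volume Q = ENNReal.ofReal ((2 * b) ^ n) := by
    rw [(PiLp.volume_preserving_ofLp (Fin n)).measure_preimage
      measurableSet_Icc.nullMeasurableSet, Real.volume_Icc_pi]
    simp only [Finset.prod_const, Finset.card_univ, Fintype.card_fin]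
    rw [← ENNReal.ofReal_pow (by linarith)]
    congr 2
    ring
  refine ENNReal.toReal_le_of_le_ofReal (by positivity) ?_
  refine (MeasureTheory.measure_mono hsub).trans_eq ?_
  rw [MeasureTheory.Measure.addHaar_image_linearMap, LinearMap.det_toLpLin, hQ, ENNReal.ofReal_mul (abs_nonneg _)]

/-! ### Ellipsoid bounds and conclusion -/

theorem EuclideanSpace.real_norm_sq_eq_dotProduct {ι : Type*} [Fintype ι]
    (x : EuclideanSpace ℝ ι) : ‖x‖ ^ 2 = x.ofLp ⬝ᵥ x.ofLp := by
  rw [EuclideanSpace.real_norm_sq_eq]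
  simp [dotProduct, sq]

/-- For a solution `u` of `S_n/S_l = 1` with values in `[0, 1]`, the eigenvalues of a quadratic form
having an ellipsoid inside the domain are controlled, above and below, by its determinant. -/
theorem eigenvalues_bounds_of_ellipsoid_subset {n l : ℕ} (hl : 1 ≤ l) (hln : l < n)
    {Ω : Set (EuclideanSpace ℝ (Fin n))} {u : EuclideanSpace ℝ (Fin n) → ℝ} (hΩ : IsOpen Ω)
    (hbdd : Bornology.IsBounded Ω) (hu : ContDiffOn ℝ 2 u Ω) (hconv : ConvexOn ℝ Ω u)
    (hS : ∀ x ∈ Ω, hessianQuotient n l (hessianMatrix u x) = 1)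
    (hu0 : ∀ y ∈ Ω, 0 ≤ u y) (hu1 : ∀ y ∈ Ω, u y ≤ 1) {N : Matrix (Fin n) (Fin n) ℝ}
    (hN : N.IsHermitian) (c : EuclideanSpace ℝ (Fin n))
    (hsub : ∀ y, (y - c).ofLp ⬝ᵥ N *ᵥ (y - c).ofLp ≤ 3 → y ∈ Ω) {K : ℝ} (hK : 1 ≤ K)
    (hNK : N.det ≤ K) (i : Fin n) : hN.eigenvalues i ≤ K ∧ (K ^ n)⁻¹ ≤ hN.eigenvalues i := by
  obtain ⟨z, hz, hle⟩ := exists_hessianMatrix_le hΩ hbdd hu hu0 hu1 N c hsub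
  have hpsd := posSemidef_hessianMatrix_of_convexOn hΩ (hu.contDiffAt (hΩ.mem_nhds hz)) hconv hz
  obtain ⟨hpos, hprod⟩ :=
    one_le_prod_eigenvalues_of_hessianQuotient_eq_one hln.le hpsd (hS z hz)
  have hmono := hpsd.1.eigenvalues_le_eigenvalues hN hle
  have hdet : ∏ i, hN.eigenvalues i ≤ K := by
    rw [hN.det_eq_prod_eigenvalues] at hNK
    simpa using hNK
  -- Here `l < n` gives `1 ≤ n - l`, and `1 ≤ l` gives `n - l < n`.
  have := Finset.bounds_of_one_le_prod (k := n - l) (by omega)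
    (by rw [Fintype.card_fin]; omega) (fun i => (hpos i).trans_le (hmono i))
    (fun S hS => (hprod S hS).trans
      (Finset.prod_le_prod (fun i _ => (hpos i).le) fun i _ => hmono i)) hK hdet i
  rwa [Fintype.card_fin] at this

/-- A quadratic form attached to an open bounded convex set `Ω` containing the origin: its
ellipsoid of level `3` lies in `Ω`, it is bounded on `Ω`, and its determinant is controlled by the
volume of `Ω`. -/
theorem exists_isHermitian_ellipsoid {n : ℕ} (hn : 0 < n) {Ω : Set (EuclideanSpace ℝ (Fin n))}
    (hΩ : IsOpen Ω) (hconv : Convex ℝ Ω) (hbdd : Bornology.IsBounded Ω)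
    (h0 : (0 : EuclideanSpace ℝ (Fin n)) ∈ Ω) :
    ∃ (N : Matrix (Fin n) (Fin n) ℝ) (c : EuclideanSpace ℝ (Fin n)), N.IsHermitian ∧ c ∈ Ω ∧
      (∀ y, (y - c).ofLp ⬝ᵥ N *ᵥ (y - c).ofLp ≤ 3 → y ∈ Ω) ∧
      (∀ x ∈ Ω, x.ofLp ⬝ᵥ N *ᵥ x.ofLp ≤ 48 * n ^ 3) ∧
      N.det ≤ (12 * n ^ 2) ^ n * 16 ^ n / (MeasureTheory.volume Ω).toReal ^ 2 := by
  obtain ⟨A, hA, hcol, hcoord⟩ := exists_matrix_col_mem_forall_eq_mulVec hΩ hbdd h0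
  have hAu : IsUnit A.det := hA.isUnit
  have hnR : (0 : ℝ) < n := by exact_mod_cast hn
  -- Chosen so that `3 / κ = (1 / (2n))²`: in the coordinates of `A`, the level-3 ellipsoid is a
  -- ball of radius `1 / (2n)`.
  set κ : ℝ := 12 * n ^ 2 with hκ
  set N : Matrix (Fin n) (Fin n) ℝ := κ • (A⁻¹ᵀ * A⁻¹) with hN
  have hform (v : Fin n → ℝ) : v ⬝ᵥ N *ᵥ v = κ * ∑ i, (A⁻¹ *ᵥ v) i ^ 2 := by
    rw [hN, Matrix.smul_mulVec, dotProduct_smul, smul_eq_mul, ← Matrix.mulVec_mulVec,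
      Matrix.dotProduct_mulVec, Matrix.vecMul_transpose]
    simp [dotProduct, sq]
  have hmem (w : Fin n → ℝ) (hw : ∀ i, 0 ≤ w i) (hw' : ∀ i, w i ≤ 1 / n) :
      WithLp.toLp 2 (A *ᵥ w) ∈ Ω := by
    have hsum : ∑ i, w i ≤ 1 := by
      calc ∑ i, w i ≤ ∑ _i : Fin n, (1 / n : ℝ) := Finset.sum_le_sum fun i _ => hw' i
        _ = 1 := by simp [hnR.ne']
    convert hconv.sum_smul_mem_of_zero_mem h0 Finset.univ (fun i _ => hw i) hsum
      (fun j _ => hcol j) using 1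
    ext i
    simp [Matrix.mulVec, dotProduct, mul_comm]
  -- Centre of the cube `[0, 1/n]ⁿ`, which sits in the standard simplex and contains that ball.
  let t : Fin n → ℝ := fun _ => 1 / (2 * n)
  have h2n : 1 / (2 * n : ℝ) + 1 / (2 * n) = 1 / n := by field_simp; norm_num
  have h2n0 : 0 < 1 / (2 * n : ℝ) := by positivity
  refine ⟨N, WithLp.toLp 2 (A *ᵥ t), ?_, ?_, ?_, ?_, ?_⟩
  · refine Matrix.IsHermitian.ext fun i j => ?_
    simp [hN, Matrix.mul_apply, mul_comm]
  · exact hmem t (fun i => h2n0.le) fun i => by simp only [t]; linarith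
  · intro y hy
    rw [hform, WithLp.ofLp_sub, Matrix.mulVec_sub, Matrix.mulVec_mulVec,
      Matrix.nonsing_inv_mul A hAu, Matrix.one_mulVec] at hy
    have hyA : y = WithLp.toLp 2 (A *ᵥ (A⁻¹ *ᵥ y.ofLp)) := by
      rw [Matrix.mulVec_mulVec, Matrix.mul_nonsing_inv A hAu, Matrix.one_mulVec]
    have hi (i : Fin n) : |(A⁻¹ *ᵥ y.ofLp) i - 1 / (2 * n)| ≤ 1 / (2 * n) := by
      refine abs_le_of_sq_le_sq ?_ h2n0.le
      have h1 : ((A⁻¹ *ᵥ y.ofLp) i - 1 / (2 * n)) ^ 2 ≤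
          ∑ i, ((A⁻¹ *ᵥ y.ofLp - t) i) ^ 2 :=
        Finset.single_le_sum (f := fun i => ((A⁻¹ *ᵥ y.ofLp - t) i) ^ 2)
          (fun i _ => sq_nonneg _) (Finset.mem_univ i)
      refine h1.trans ?_
      have hκ0 : 0 < κ := by positivity
      rw [mul_comm, ← le_div_iff₀ hκ0] at hy
      refine hy.trans_eq ?_
      rw [hκ]
      field_simp
      norm_num
    rw [hyA]
    refine hmem _ (fun i => ?_) fun i => ?_
    · linarith [(abs_le.1 (hi i)).1]
    · linarith [(abs_le.1 (hi i)).2]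
  · intro x hx
    obtain ⟨y, hxy, hy⟩ := hcoord x hx
    rw [hform, hxy, Matrix.mulVec_mulVec, Matrix.nonsing_inv_mul A hAu, Matrix.one_mulVec]
    have : ∑ i, y i ^ 2 ≤ n * 4 := by
      calc ∑ i, y i ^ 2 ≤ ∑ _i : Fin n, (4 : ℝ) := Finset.sum_le_sum fun i _ => by
            nlinarith [abs_le.1 (hy i)]
        _ = n * 4 := by simp
    calc κ * ∑ i, y i ^ 2 ≤ κ * (n * 4) := by gcongr
      _ = 48 * n ^ 3 := by rw [hκ]; ring
  · have hV : 0 < (MeasureTheory.volume Ω).toReal :=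
      ENNReal.toReal_pos (hΩ.measure_pos _ ⟨0, h0⟩).ne' hbdd.measure_lt_top.ne
    have hVA := volume_le_of_forall_eq_mulVec (b := 2) (by norm_num) hcoord
    have hdet : N.det = κ ^ n / A.det ^ 2 := by
      rw [hN, Matrix.det_smul, Matrix.det_mul, Matrix.det_transpose, Matrix.det_nonsing_inv,
        Ring.inverse_eq_inv', Fintype.card_fin]
      field_simp
    have hA2 : 0 < A.det ^ 2 := by positivity
    have hsq : (MeasureTheory.volume Ω).toReal ^ 2 ≤ A.det ^ 2 * 16 ^ n := by
      calc (MeasureTheory.volume Ω).toReal ^ 2 ≤ (|A.det| * (2 * 2) ^ n) ^ 2 := by gcongr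
        _ = A.det ^ 2 * 16 ^ n := by
          rw [mul_pow, sq_abs, ← pow_mul, mul_comm n 2, pow_mul]
          norm_num
    rw [hdet, div_le_div_iff₀ hA2 (by positivity), mul_assoc, mul_comm (16 ^ n)]
    gcongr

theorem theorem6p2 (n l : ℕ) (hl : 1 ≤ l) (hln : l < n) :
    ∃ γ : ℝ → ℝ, (∀ V : ℝ, 1 < γ V) ∧
      ∀ (Ω : Set (EuclideanSpace ℝ (Fin n))) (u : EuclideanSpace ℝ (Fin n) → ℝ),
        IsOpen Ω → Convex ℝ Ω → Bornology.IsBounded Ω → (0 : EuclideanSpace ℝ (Fin n)) ∈ Ω →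
        ContDiffOn ℝ 2 u Ω → ContinuousOn u (closure Ω) → ConvexOn ℝ Ω u →
        (∀ x ∈ Ω, hessianQuotient n l (hessianMatrix u x) = 1) →
        u 0 = 0 → gradient u 0 = 0 → (∀ x ∈ frontier Ω, u x = 1) →
        GammaBallCondition (γ (MeasureTheory.volume Ω).toReal) Ω := by
  let K : ℝ → ℝ := fun V => max 1 ((12 * n ^ 2) ^ n * 16 ^ n / V ^ 2)
  have hK1 (V : ℝ) : 1 ≤ K V := le_max_left _ _
  have hn1 : (1 : ℝ) ≤ n := by exact_mod_cast (by omega : 1 ≤ n)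
  let ρ : ℝ → ℝ := fun V => 48 * n ^ 3 * K V ^ n
  have hρ1 (V : ℝ) : 1 ≤ ρ V := by
    have h1 : (1 : ℝ) ≤ n ^ 3 := one_le_pow₀ hn1
    have h2 : (1 : ℝ) ≤ K V ^ n := one_le_pow₀ (hK1 V)
    exact one_le_mul_of_one_le_of_one_le (by linarith) h2
  -- With `R = 1`, `K V` serves the inner ball and `2 * ρ V` the outer one, since `‖y - c‖ ≤ ‖y‖ +
  -- ‖c‖`.
  refine ⟨fun V => K V + 2 * ρ V, fun V => by linarith [hK1 V, hρ1 V], ?_⟩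
  intro Ω u hΩ hconvΩ hbdd h0 hu hcont hconv hS hu0 hgrad hfr
  generalize hV : (MeasureTheory.volume Ω).toReal = V
  have hnonneg (y) (hy : y ∈ Ω) : 0 ≤ u y :=
    hconv.nonneg_of_gradient_eq_zero h0
      ((hu.contDiffAt (hΩ.mem_nhds h0)).differentiableAt (by simp)) hu0 hgrad hy
  have hle1 (y) (hy : y ∈ Ω) : u y ≤ 1 :=
    hconv.le_of_le_on_frontier zero_le_one hΩ hbdd hcont h0 hu0 (fun x hx => (hfr x hx).le) hy
  obtain ⟨N, c, hN, hc, hsub, hup, hdet⟩ :=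
    exists_isHermitian_ellipsoid (by omega) hΩ hconvΩ hbdd h0
  rw [hV] at hdet
  have hev := eigenvalues_bounds_of_ellipsoid_subset hl hln hΩ hbdd hu hconv hS hnonneg hle1 hN c
    hsub (hK1 V) (hdet.trans (le_max_right _ _))
  have hKpos : 0 < K V := zero_lt_one.trans_le (hK1 V)
  have hnorm (x) (hx : x ∈ Ω) : ‖x‖ ≤ ρ V := by
    have h1 := (hN.le_dotProduct_mulVec (fun i => (hev i).2) x.ofLp).trans (hup x hx)
    rw [← EuclideanSpace.real_norm_sq_eq_dotProduct, inv_mul_le_iff₀ (by positivity)] at h1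
    have h2 : ‖x‖ ^ 2 ≤ ρ V := h1.trans_eq (mul_comm _ _)
    refine abs_le_of_sq_le_sq' (h2.trans ?_) (by linarith [hρ1 V]) |>.2
    exact le_self_pow₀ (hρ1 V) two_ne_zero
  refine ⟨c, 1, one_pos, fun y hy => hsub y ?_, fun y hy => ?_⟩
  · refine (hN.dotProduct_mulVec_le (fun i => (hev i).1) _).trans ?_
    rw [← EuclideanSpace.real_norm_sq_eq_dotProduct]
    rw [Metric.mem_ball, dist_eq_norm, mul_one] at hy
    have h1 : ‖y - c‖ ≤ (K V)⁻¹ :=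
      hy.le.trans (inv_anti₀ hKpos (by linarith [hρ1 V]))
    calc K V * ‖y - c‖ ^ 2 ≤ K V * (K V)⁻¹ ^ 2 := by gcongr
      _ = (K V)⁻¹ := by field_simp
      _ ≤ 3 := (inv_le_one_of_one_le₀ (hK1 V)).trans (by norm_num)
  · rw [Metric.mem_ball, dist_eq_norm, mul_one]
    linarith [norm_sub_le y c, hnorm y hy, hnorm c hc]
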